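/- **Lemma 1.1.** Let $E$, $M$, $S$ be smooth finite-dimensional manifolds without boundary, let $p:E\to M$ be a locally trivial smooth fiber bundle with standard fiber $S$, and let $\omega\in\Omega^2(E)$ be a symplectic form (smooth, closed, nondegenerate). Write $V_uE=\ker(T_up)$ for the vertical space at $u\in E$, i.e. the tangent space at $u$ of the fiber through $u$. Let $\Theta\in\Omega^1(E)$ be a smooth *Liouville form*, that is: 1. $\Theta$ is horizontal: $\Theta_u(Y)=0$ for all $u\in E$ and $Y\in V_uE$; 2. $\omega=d\Theta$; 3. the fibers of $p$ are Lagrangian submanifolds of $(E,\omega)$: for every $u\in E$, $V_uE$ equals its own $\omega_u$-orthogonal complement. Let $\pi:T^*M\to M$ be the cotangent bundle and $\Theta_M\in\Omega^1(T^*M)$ its canonical Liouville form, $(\Theta_M)_\xi(w)=\xi(T_\xi\pi\, w)$ for $\xi\in T^*M$, $w\in T_\xi(T^*M)$. Then $(E,\Theta)$ is locally fiber-respecting diffeomorphic to $(T^*M,\Theta_M)$: for every $u\in E$ there are an open neighbourhood $U$ of $u$ in $E$, an open subset $W\subseteq T^*M$ and a smooth diffeomorphism $\varphi:U\to W$ such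 that $\pi\circ\varphi=p|_U$ and $\varphi^*\Theta_M=\Theta|_U$. -/

import Mathlib

open scoped Manifold ContDiff Bundle

noncomputable section

namespace LiouvilleBundle

universe uV uH uX uV' uH' uX' uF uK uS

variable {V : Type uV} [NormedAddCommGroup V] [NormedSpace ℝ V]
  {H : Type uH} [TopologicalSpace H] (I : ModelWithCorners ℝ V H)
  {X : Type uX} [TopologicalSpace X] [ChartedSpace H X]
  {V' : Type uV'} [NormedAddCommGroup V'] [NormedSpace ℝ V']
  {H' : Type uH'} [TopologicalSpace H'] (I' : ModelWithCorners ℝ V' H')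
  {X' : Type uX'} [TopologicalSpace X'] [ChartedSpace H' X']

/-! ### Differential forms on manifolds -/

/-- A (not necessarily smooth) differential `k`-form on the manifold `X`: an alternating `k`-linear
form on each tangent space. -/
abbrev Form (X : Type uX) [TopologicalSpace X] [ChartedSpace H X] (k : ℕ) : Type max uV uX :=
  ∀ x : X, TangentSpace I x [⋀^Fin k]→L[ℝ] ℝ

/-- The pullback `f^* η`, given by `(f^* η)_x (v₁, …, v_k) = η_{f x} (T_x f v₁, …, T_x f v_k)`. -/
def pullback {k : ℕ} (f : X → X') (η : Form I' X' k) : Form I X k :=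
  fun x => (η (f x)).compContinuousLinearMap (mfderiv I I' f x)

/-- The local representative of a `k`-form in the preferred chart at `x₀`, as a form on the model
vector space; it is meaningful on the target of the chart. -/
def localRep {k : ℕ} (η : Form I X k) (x₀ : X) : V → V [⋀^Fin k]→L[ℝ] ℝ :=
  pullback 𝓘(ℝ, V) I (extChartAt I x₀).symm η

/-- A `k`-form is smooth if its representatives in the charts of the manifold (without boundary)
are smooth. -/
def IsSmoothForm {k : ℕ} (η : Form I X k) : Prop :=
  ∀ x₀ : X, ContDiffOn ℝ ∞ (localRep I η x₀) (extChartAt I x₀).target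

/-- The exterior derivative of a `k`-form: at `x`, differentiate the representative in the
chart at `x` and pull the result back to the manifold. -/
def extDerivForm {k : ℕ} (η : Form I X k) : Form I X (k + 1) := fun x =>
  pullback I 𝓘(ℝ, V) (extChartAt I x) (extDeriv (localRep I η x)) x

/-- A symplectic form: a smooth, closed and nondegenerate 2-form. -/
structure IsSymplecticForm (Ω : Form I X 2) : Prop where
  smooth : IsSmoothForm I Ω
  closed : extDerivForm I Ω = 0
  nondegenerate : ∀ (x : X) (v : TangentSpace I x), (∀ w : TangentSpace I x, Ω x ![v, w] = 0) → v = 0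

/-- A linear subspace `L` of the tangent space at `x` is Lagrangian for the symplectic form `Ω` if
it equals its own `Ω`-orthogonal. -/
def IsLagrangianSubspace (Ω : Form I X 2) (x : X) (L : Submodule ℝ (TangentSpace I x)) : Prop :=
  ∀ v : TangentSpace I x, v ∈ L ↔ ∀ w ∈ L, Ω x ![v, w] = 0

/-! ### Smooth fiber bundles -/

/-- The vertical space `V_u E = ker (T_u p)`. For a smooth fiber bundle it is the tangent space at
`u` of the fiber through `u`. -/
def verticalSpace (p : X → X') (u : X) : Submodule ℝ (TangentSpace I u) :=
  LinearMap.ker (mfderiv I I' p u).toLinearMap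

/-- `p : X → X'` is a locally trivial smooth fiber bundle with standard fiber the manifold `S`:
`p` is smooth and every point of `X'` has an open neighbourhood `U` such that `p ⁻¹ U` is
diffeomorphic to `U × S` over `U`. -/
structure IsSmoothFiberBundle {F : Type uF} [NormedAddCommGroup F] [NormedSpace ℝ F]
    {K : Type uK} [TopologicalSpace K] (J : ModelWithCorners ℝ F K)
    (S : Type uS) [TopologicalSpace S] [ChartedSpace K S] (p : X → X') : Prop where
  smooth : ContMDiff I I' ∞ p
  locally_trivial : ∀ x : X', ∃ e : Bundle.Trivialization S p, x ∈ e.baseSet ∧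
    ContMDiffOn I (I'.prod J) ∞ e e.source ∧
    ContMDiffOn (I'.prod J) I ∞ e.toOpenPartialHomeomorph.symm e.target

/-- A Liouville form on the total space of the bundle `p`, with respect to the symplectic form `Ω`:
a smooth 1-form `Θ` which is horizontal and satisfies `Ω = dΘ`, where moreover the fibers of `p`
are Lagrangian. -/
structure IsLiouvilleForm (p : X → X') (Ω : Form I X 2) (Θ : Form I X 1) : Prop where
  smooth : IsSmoothForm I Θ
  horizontal : ∀ (u : X), ∀ v ∈ verticalSpace I I' p u, Θ u ![v] = 0
  eq_extDeriv : Ω = extDerivForm I Θ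
  lagrangian_fibers : ∀ u : X, IsLagrangianSubspace I Ω u (verticalSpace I I' p u)

/-! ### The cotangent bundle and its canonical Liouville form -/

/-- The cotangent bundle `T^*X`: the bundle of continuous linear maps from the tangent bundle to the
trivial line bundle, with the smooth structure of a hom bundle. -/
abbrev CotangentBundle (X : Type uX) [TopologicalSpace X] [ChartedSpace H X] : Type max uV uX :=
  Bundle.TotalSpace (V →L[ℝ] ℝ) (fun x : X => TangentSpace I x →L[ℝ] Bundle.Trivial X ℝ x)

/-- The model with corners of the cotangent bundle. -/
abbrev cotangentModel : ModelWithCorners ℝ (V × (V →L[ℝ] ℝ)) (ModelProd H (V →L[ℝ] ℝ)) :=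
  I.prod 𝓘(ℝ, V →L[ℝ] ℝ)

/-- The canonical Liouville form on the cotangent bundle `π : T^*X → X`: at the covector `ξ` it
sends a tangent vector `w` to `ξ (T_ξ π w)`. -/
def canonicalLiouvilleForm [IsManifold I 1 X] :
    Form (cotangentModel I) (CotangentBundle I X) 1 := fun ξ =>
  ContinuousAlternatingMap.ofSubsingleton ℝ (TangentSpace (cotangentModel I) ξ) ℝ (0 : Fin 1)
    (ContinuousLinearMap.comp (M₂ := TangentSpace I ξ.proj) (M₃ := ℝ) ξ.snd
      (mfderiv (cotangentModel I) I
        (Bundle.TotalSpace.proj : CotangentBundle I X → X) ξ))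

end LiouvilleBundle

end

/-! Since `Θ` is horizontal and `p` is a submersion, `Θ_u = q(u) ∘ T_u p` for a unique covector
`q(u)` at `p u`. The required map is `φ(u) = (p u, q(u))`: it lies over the base, and `φ^*Θ_M = Θ`
is then immediate from the definition of `Θ_M`. What needs proof is that `φ` is smooth and a local
diffeomorphism.

In charts, write `P` for `p` and `θ = q ∘ DP`. Smoothness of `q` is `exists_factor_through_fderiv`.
Differentiating and antisymmetrising, the second derivative of `P` cancels, which leaves `dθ(v, w) =
Dq(v)(DP w) - Dq(w)(DP v)`. A vector killed by both `DP` and `Dq` is thus in the radical of `dθ` and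
vanishes by nondegeneracy, so `Dφ` is injective. The Lagrangian condition gives `dim E = 2 dim M`
(`finrank_eq_of_lagrangian_ker`), so `Dφ` is bijective and the inverse function theorem applies.
This is the vector space version of `exists_canonical_coordinates`.

The transfer to manifolds rests on two facts: the chart of `E` carries `Ω`, `Θ` and the vertical
spaces to `dθ`, `θ` and `ker DP`, and the fiber coordinate on `T^*M` is the covector read in the
chart of `M` (`cotangentChart_snd`). -/

noncomputable section

namespace LiouvilleBundle

open Set Filter Topology

/-! ### Local normal form on vector spaces -/

section VectorSpace

variable {V W : Type*} [NormedAddCommGroup V] [NormedSpace ℝ V]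
  [NormedAddCommGroup W] [NormedSpace ℝ W]

/-- A continuously differentiable map whose derivative at a point is invertible restricts to a
diffeomorphism near that point. -/
theorem exists_openPartialHomeomorph_of_isInvertible_fderiv [CompleteSpace V]
    {U : Set V} (hU : IsOpen U) {y₀ : V} (hy₀ : y₀ ∈ U) {f : V → W}
    (hf : ContDiffOn ℝ ∞ f U) (hinv : (fderiv ℝ f y₀).IsInvertible) :
    ∃ ψ : OpenPartialHomeomorph V W, y₀ ∈ ψ.source ∧ ψ.source ⊆ U ∧ ⇑ψ = f ∧
      ContDiffOn ℝ ∞ ψ.symm ψ.target := by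
  obtain ⟨e, he⟩ := hinv
  have hfa : ∀ y ∈ U, ContDiffAt ℝ ∞ f y := fun y hy => hf.contDiffAt (hU.mem_nhds hy)
  have hd : HasFDerivAt f (e : V →L[ℝ] W) y₀ := by
    rw [he]; exact ((hfa y₀ hy₀).differentiableAt (by simp)).hasFDerivAt
  have hcont : ContinuousOn (fderiv ℝ f) U := hf.continuousOn_fderiv_of_isOpen hU (by simp)
  -- The inverse function theorem makes the inverse smooth only near the image of `y₀`; restricting
  -- to the open set where the derivative is invertible makes it smooth on the whole target.
  set N : Set V := U ∩ fderiv ℝ f ⁻¹' range ((↑) : (V ≃L[ℝ] W) → V →L[ℝ] W)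
  have hN : IsOpen N := hcont.isOpen_inter_preimage hU (ContinuousLinearEquiv.isOpen)
  have hy₀N : y₀ ∈ N := ⟨hy₀, e, he⟩
  set g := (hfa y₀ hy₀).toOpenPartialHomeomorph f hd (by simp)
  refine ⟨g.restrOpen N hN, ?_, ?_, rfl, ?_⟩
  · exact ⟨(hfa y₀ hy₀).mem_toOpenPartialHomeomorph_source hd (by simp), hy₀N⟩
  · exact fun y hy => hy.2.1
  · intro z hz
    obtain ⟨hU', e', he'⟩ : (g.restrOpen N hN).symm z ∈ N :=
      ((g.restrOpen N hN).map_target hz).2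
    refine ((g.restrOpen N hN).contDiffAt_symm (f₀' := e') hz ?_ ?_).contDiffWithinAt
    · rw [he']
      exact ((hfa _ hU').differentiableAt (by simp)).hasFDerivAt
    · exact hfa _ hU'

/-- If the kernel of a surjective linear map `V → W` is its own orthogonal for a nondegenerate
alternating form, then `dim V = 2 dim W`. -/
theorem finrank_eq_of_lagrangian_ker [FiniteDimensional ℝ V] [FiniteDimensional ℝ W]
    (B : LinearMap.BilinForm ℝ V) (hB : ∀ v, (∀ w, B v w = 0) → v = 0)
    (halt : B.IsAlt) {A : V →ₗ[ℝ] W} (hA : Function.Surjective A)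
    (hlag : ∀ v, A v = 0 ↔ ∀ w, A w = 0 → B v w = 0) :
    Module.finrank ℝ V = Module.finrank ℝ W + Module.finrank ℝ W := by
  have hrefl : B.IsRefl := halt.isRefl
  have hnd : B.Nondegenerate := 
    hrefl.nondegenerate_iff_separatingLeft.2 hB
  have horth : B.orthogonal (LinearMap.ker A) = LinearMap.ker A := by
    ext v
    rw [LinearMap.BilinForm.mem_orthogonal_iff, LinearMap.mem_ker, hlag]
    exact ⟨fun h w hw => hrefl _ _ (h w hw), fun h w hw => hrefl _ _ (h w hw)⟩
  -- For `K = ker A` this reads `dim K = dim V - dim K`, while rank-nullity gives `dim V - dim K =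
  -- dim W`.
  have h1 := LinearMap.BilinForm.finrank_orthogonal hnd (LinearMap.ker A)
  rw [horth] at h1
  have h2 := A.finrank_range_add_finrank_ker
  rw [LinearMap.range_eq_top.2 hA, finrank_top] at h2
  omega

theorem isInvertible_of_injective_of_finrank_eq [FiniteDimensional ℝ V] [FiniteDimensional ℝ W]
    {f : V →L[ℝ] W} (hf : ∀ v, f v = 0 → v = 0)
    (hdim : Module.finrank ℝ V = Module.finrank ℝ W) : f.IsInvertible := by
  have hinj : Function.Injective f.toLinearMap := (injective_iff_map_eq_zero _).2 hf
  exact ⟨(LinearMap.linearEquivOfInjective f.toLinearMap hinj hdim).toContinuousLinearEquiv, by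
    ext v; rfl⟩

/-- Horizontal 1-forms factor smoothly through the derivative of a submersion. -/
theorem exists_factor_through_fderiv [FiniteDimensional ℝ W]
    {U : Set V} (hU : IsOpen U) {y₀ : V} (hy₀ : y₀ ∈ U)
    {P : V → W} (hP : ContDiffOn ℝ ∞ P U) {θ : V → V →L[ℝ] ℝ} (hθ : ContDiffOn ℝ ∞ θ U)
    (hsurj : Function.Surjective (fderiv ℝ P y₀))
    (hhor : ∀ y ∈ U, ∀ v, fderiv ℝ P y v = 0 → θ y v = 0) :
    ∃ U' ⊆ U, IsOpen U' ∧ y₀ ∈ U' ∧ ∃ q : V → W →L[ℝ] ℝ, ContDiffOn ℝ ∞ q U' ∧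
      ∀ y ∈ U', θ y = (q y).comp (fderiv ℝ P y) := by
  have : CompleteSpace W := FiniteDimensional.complete ℝ W
  obtain ⟨R₀, hR₀⟩ := LinearMap.exists_rightInverse_of_surjective (fderiv ℝ P y₀).toLinearMap
    (LinearMap.range_eq_top.2 hsurj)
  set R : W →L[ℝ] V := R₀.toContinuousLinearMap
  have hR : ∀ w, fderiv ℝ P y₀ (R w) = w := fun w => LinearMap.congr_fun hR₀ w
  -- `R` is a right inverse of `DP` at `y₀` only. `A` is the identity there, hence invertible
  -- nearby, and `R ∘ A⁻¹` is a right inverse of `DP` that varies smoothly with the point.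
  set A : V → W →L[ℝ] W := fun y => (fderiv ℝ P y).comp R
  have hDP : ContDiffOn ℝ ∞ (fderiv ℝ P) U := hP.fderiv_of_isOpen hU (by simp)
  have hA : ContDiffOn ℝ ∞ A U := hDP.clm_comp contDiffOn_const
  set U' : Set V := U ∩ A ⁻¹' range ((↑) : (W ≃L[ℝ] W) → W →L[ℝ] W)
  have hU' : IsOpen U' := hA.continuousOn.isOpen_inter_preimage hU (ContinuousLinearEquiv.isOpen)
  have hy₀' : y₀ ∈ U' := ⟨hy₀, ContinuousLinearEquiv.refl ℝ W, by ext w; exact (hR w).symm⟩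
  refine ⟨U', inter_subset_left, hU', hy₀',
    fun y => ((θ y).comp R).comp (A y).inverse, ?_, ?_⟩
  · refine ((hθ.mono inter_subset_left).clm_comp contDiffOn_const).clm_comp ?_
    intro y hy
    obtain ⟨e, he⟩ := hy.2
    have h : ContDiffAt ℝ ∞ ContinuousLinearMap.inverse (A y) := he ▸ contDiffAt_map_inverse e
    exact h.comp_contDiffWithinAt y ((hA y hy.1).mono inter_subset_left)
  · rintro y ⟨hyU, e, he⟩
    ext v
    -- The vector `v - R A⁻¹ DP v` lies in `ker DP`, so `θ` takes equal values on `v` and `R A⁻¹ DP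
    -- v`.
    have h := hhor y hyU (v - R ((A y).inverse (fderiv ℝ P y v))) (by
      have : (fderiv ℝ P y) (R ((A y).inverse (fderiv ℝ P y v))) =
        A y ((A y).inverse (fderiv ℝ P y v)) := rfl
      rw [map_sub, this, ← he]
      simp)
    rw [map_sub, sub_eq_zero] at h
    exact h

/-- The vector space version of the local normal form: near a point where `dθ` is nondegenerate and
the kernel of the derivative of the submersion `P` is Lagrangian, a horizontal 1-form `θ` is the
pullback of the canonical form `q dp`. -/
theorem exists_canonical_coordinates [FiniteDimensional ℝ V] [FiniteDimensional ℝ W]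
    {U : Set V} (hU : IsOpen U) {y₀ : V} (hy₀ : y₀ ∈ U)
    {P : V → W} (hP : ContDiffOn ℝ ∞ P U) {θ : V → V →L[ℝ] ℝ} (hθ : ContDiffOn ℝ ∞ θ U)
    (hsurj : Function.Surjective (fderiv ℝ P y₀))
    (hhor : ∀ y ∈ U, ∀ v, fderiv ℝ P y v = 0 → θ y v = 0)
    (hnondeg : ∀ v, (∀ w, fderiv ℝ θ y₀ v w - fderiv ℝ θ y₀ w v = 0) → v = 0)
    (hlag : ∀ v, fderiv ℝ P y₀ v = 0 ↔
      ∀ w, fderiv ℝ P y₀ w = 0 → fderiv ℝ θ y₀ v w - fderiv ℝ θ y₀ w v = 0) :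
    ∃ ψ : OpenPartialHomeomorph V (W × (W →L[ℝ] ℝ)), y₀ ∈ ψ.source ∧ ψ.source ⊆ U ∧
      ContDiffOn ℝ ∞ ψ ψ.source ∧ ContDiffOn ℝ ∞ ψ.symm ψ.target ∧
      ∀ y ∈ ψ.source, (ψ y).1 = P y ∧ θ y = (ψ y).2.comp (fderiv ℝ P y) := by
  have : CompleteSpace V := FiniteDimensional.complete ℝ V
  obtain ⟨U', hU'U, hU', hy₀', q, hq, hqθ⟩ := exists_factor_through_fderiv hU hy₀ hP hθ hsurj hhor
  have hP' := hP.mono hU'U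
  have hPa := hP'.contDiffAt (hU'.mem_nhds hy₀')
  have hPd := (hPa.differentiableAt (by simp)).hasFDerivAt
  have hDPd := ((hPa.fderiv_right (m := 1) (by norm_cast)).differentiableAt (by simp)).hasFDerivAt
  have hqd := ((hq.contDiffAt (hU'.mem_nhds hy₀')).differentiableAt (by simp)).hasFDerivAt
  have hsymm : IsSymmSndFDerivAt ℝ P y₀ := hPa.isSymmSndFDerivAt (by
    simp only [minSmoothness_of_isRCLikeNormedField]; norm_cast)
  -- Product rule for `θ = q ∘ DP`. The first term is symmetric in `v` and `w` by `hsymm`, so it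
  -- drops out of `dθ`.
  have hθd : ∀ v w, fderiv ℝ θ y₀ v w =
      q y₀ (fderiv ℝ (fderiv ℝ P) y₀ v w) + fderiv ℝ q y₀ v (fderiv ℝ P y₀ w) := by
    intro v w
    have heq : θ =ᶠ[𝓝 y₀] fun y => (q y).comp (fderiv ℝ P y) :=
      (hU'.eventually_mem hy₀').mono hqθ
    rw [heq.fderiv_eq, (hqd.clm_comp hDPd).fderiv]
    simp
  have hfd : HasFDerivAt (fun y => (P y, q y)) ((fderiv ℝ P y₀).prod (fderiv ℝ q y₀)) y₀ :=
    hPd.prodMk hqd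
  have hinv : (fderiv ℝ (fun y => (P y, q y)) y₀).IsInvertible := by
    rw [hfd.fderiv]
    apply isInvertible_of_injective_of_finrank_eq
    · intro v hv
      have h1 : fderiv ℝ P y₀ v = 0 := congrArg Prod.fst hv
      have h2 : fderiv ℝ q y₀ v = 0 := congrArg Prod.snd hv
      refine hnondeg v fun w => ?_
      rw [hθd, hθd, h1, h2, hsymm v w]
      simp
    · set B : LinearMap.BilinForm ℝ V := (ContinuousLinearMap.toLinearMap₁₂ (fderiv ℝ θ y₀)) -
        (ContinuousLinearMap.toLinearMap₁₂ (fderiv ℝ θ y₀)).flip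
      have hdim := finrank_eq_of_lagrangian_ker B hnondeg (fun v => sub_self _)
        (A := (fderiv ℝ P y₀).toLinearMap) hsurj hlag
      have hdual : Module.finrank ℝ (W →L[ℝ] ℝ) = Module.finrank ℝ W := by
        rw [← (LinearMap.toContinuousLinearMap (𝕜 := ℝ) (E := W) (F' := ℝ)).finrank_eq]
        exact Subspace.dual_finrank_eq
      rw [Module.finrank_prod, hdual, hdim]
  obtain ⟨ψ, hψ₀, hψU, hψ, hψs⟩ :=
    exists_openPartialHomeomorph_of_isInvertible_fderiv hU' hy₀' (hP'.prodMk hq) hinv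
  refine ⟨ψ, hψ₀, hψU.trans hU'U, ?_, hψs, fun y hy => ?_⟩
  · rw [hψ]; exact (hP'.prodMk hq).mono hψU
  · rw [hψ]; exact ⟨rfl, hqθ y (hψU hy)⟩

end VectorSpace

/-! ### One-forms as maps into the dual space -/

section Forms

variable {V : Type*} [NormedAddCommGroup V] [NormedSpace ℝ V]

variable (V) in
/-- Linear forms are the same as alternating 1-forms. -/
def ofSubsingletonEquiv : (V →L[ℝ] ℝ) ≃ₗᵢ[ℝ] (V [⋀^Fin 1]→L[ℝ] ℝ) :=
  ContinuousAlternatingMap.ofSubsingletonLIE 0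

/-- A family of alternating 1-forms on a vector space, viewed as a family of linear forms. -/
def toLinearForm (η : V → V [⋀^Fin 1]→L[ℝ] ℝ) : V → V →L[ℝ] ℝ := fun y =>
  (ofSubsingletonEquiv V).symm (η y)

theorem toLinearForm_apply (η : V → V [⋀^Fin 1]→L[ℝ] ℝ) (y v : V) :
    toLinearForm η y v = η y ![v] := by
  have h : (fun _ : Fin 1 => v) = ![v] := by ext i; fin_cases i; rfl
  rw [← h]
  rfl

theorem contDiffOn_toLinearForm {η : V → V [⋀^Fin 1]→L[ℝ] ℝ} {s : Set V} {n : WithTop ℕ∞}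
    (h : ContDiffOn ℝ n η s) : ContDiffOn ℝ n (toLinearForm η) s :=
  (ofSubsingletonEquiv V).symm.contDiff.comp_contDiffOn h

theorem extDeriv_eq_fderiv_toLinearForm {η : V → V [⋀^Fin 1]→L[ℝ] ℝ} {y : V}
    (h : DifferentiableAt ℝ η y) (v w : V) :
    extDeriv η y ![v, w] =
      fderiv ℝ (toLinearForm η) y v w - fderiv ℝ (toLinearForm η) y w v := by
  have hd : DifferentiableAt ℝ (toLinearForm η) y :=
    (ofSubsingletonEquiv V).symm.toContinuousLinearEquiv.differentiableAt.comp y h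
  have key : ∀ a b : V, fderiv ℝ (fun z => η z ![a]) y b = fderiv ℝ (toLinearForm η) y b a := by
    intro a b
    simp_rw [← toLinearForm_apply]
    rw [fderiv_clm_apply hd (differentiableAt_const a)]
    simp
  rw [extDeriv_apply h]
  have h0 : (0 : Fin 2).removeNth ![v, w] = ![w] := by ext i; fin_cases i; rfl
  have h1 : (1 : Fin 2).removeNth ![v, w] = ![v] := by ext i; fin_cases i; rfl
  rw [Fin.sum_univ_two, h0, h1, key, key]
  simp [sub_eq_add_neg]

end Forms

/-! ### Forms read in a chart -/

section Charts

variable {V : Type*} [NormedAddCommGroup V] [NormedSpace ℝ V]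
  {H : Type*} [TopologicalSpace H] (I : ModelWithCorners ℝ V H) [I.Boundaryless]
  {X : Type*} [TopologicalSpace X] [ChartedSpace H X]

/-- The extended chart at a point of a manifold without boundary is an open partial
homeomorphism to the model vector space. -/
def chartHomeomorph (x₀ : X) : OpenPartialHomeomorph X V :=
  (chartAt H x₀).transHomeomorph I.toHomeomorph

theorem chartHomeomorph_source (x₀ : X) : (chartHomeomorph I x₀).source = (chartAt H x₀).source :=
  rfl

theorem chartHomeomorph_target (x₀ : X) :
    (chartHomeomorph I x₀).target = (extChartAt I x₀).target := by
  rw [extChartAt_target, I.range_eq_univ, inter_univ]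
  rfl

theorem contMDiffOn_chartHomeomorph [IsManifold I ∞ X] (x₀ : X) :
    ContMDiffOn I 𝓘(ℝ, V) ∞ (chartHomeomorph I x₀) (chartHomeomorph I x₀).source :=
  contMDiffOn_extChartAt

theorem contMDiffOn_chartHomeomorph_symm [IsManifold I ∞ X] (x₀ : X) :
    ContMDiffOn 𝓘(ℝ, V) I ∞ (chartHomeomorph I x₀).symm (chartHomeomorph I x₀).target := by
  rw [chartHomeomorph_target]
  exact contMDiffOn_extChartAt_symm x₀

theorem mfderiv_extChartAt_symm_mfderiv_extChartAt [IsManifold I ∞ X] {x₀ x : X}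
    (hx : x ∈ (chartAt H x₀).source) (Y : TangentSpace I x) :
    mfderiv 𝓘(ℝ, V) I (extChartAt I x₀).symm (extChartAt I x₀ x)
      (mfderiv I 𝓘(ℝ, V) (extChartAt I x₀) x Y) = Y := by
  have : IsManifold I 1 X := IsManifold.of_le (n := ∞) (by simp)
  have h := mfderivWithin_extChartAt_symm_comp_mfderiv_extChartAt' (I := I) (x := x₀) (y := x)
    (by rwa [extChartAt_source])
  rw [I.range_eq_univ, mfderivWithin_univ] at h
  exact DFunLike.congr_fun h Y

omit [I.Boundaryless] in
theorem mfderiv_extChartAt_bijective [IsManifold I ∞ X] {x₀ x : X}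
    (hx : x ∈ (chartAt H x₀).source) :
    Function.Bijective (mfderiv I 𝓘(ℝ, V) (extChartAt I x₀) x) := by
  have : IsManifold I 1 X := IsManifold.of_le (n := ∞) (by simp)
  exact (isInvertible_mfderiv_extChartAt (I := I) (x := x₀) (y := x)
    (by rwa [extChartAt_source])).bijective

theorem toLinearForm_localRep [IsManifold I ∞ X] (η : Form I X 1) {x₀ x : X}
    (hx : x ∈ (chartAt H x₀).source) (Y : TangentSpace I x) :
    toLinearForm (localRep I η x₀) (extChartAt I x₀ x)
      (mfderiv I 𝓘(ℝ, V) (extChartAt I x₀) x Y) = η x ![Y] := by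
  have hx' : (extChartAt I x₀).symm (extChartAt I x₀ x) = x :=
    (extChartAt I x₀).left_inv (by rwa [extChartAt_source])
  have hY := mfderiv_extChartAt_symm_mfderiv_extChartAt I hx Y
  refine (toLinearForm_apply _ _ _).trans ?_
  change η ((extChartAt I x₀).symm (extChartAt I x₀ x))
    (mfderiv 𝓘(ℝ, V) I (extChartAt I x₀).symm (extChartAt I x₀ x) ∘
      ![mfderiv I 𝓘(ℝ, V) (extChartAt I x₀) x Y]) = η x ![Y]
  have hvec : (mfderiv 𝓘(ℝ, V) I (extChartAt I x₀).symm (extChartAt I x₀ x) ∘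
      ![mfderiv I 𝓘(ℝ, V) (extChartAt I x₀) x Y]) = ![Y] := by
    ext i; fin_cases i; exact hY
  rw [hvec]
  exact congrArg (fun z => (show V [⋀^Fin 1]→L[ℝ] ℝ from η z) ![Y]) hx'

/-- The derivative is taken in the chart centred at `x`, as in the definition of `extDerivForm`. The
centre suffices later: nondegeneracy and the Lagrangian condition are used at the single point `u`.
-/
theorem extDerivForm_apply {η : Form I X 1} (hη : IsSmoothForm I η) (x : X)
    (Y Z : TangentSpace I x) :
    extDerivForm I η x ![Y, Z] =
      fderiv ℝ (toLinearForm (localRep I η x)) (extChartAt I x x)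
          (mfderiv I 𝓘(ℝ, V) (extChartAt I x) x Y) (mfderiv I 𝓘(ℝ, V) (extChartAt I x) x Z) -
        fderiv ℝ (toLinearForm (localRep I η x)) (extChartAt I x x)
          (mfderiv I 𝓘(ℝ, V) (extChartAt I x) x Z)
          (mfderiv I 𝓘(ℝ, V) (extChartAt I x) x Y) := by
  have hd : DifferentiableAt ℝ (localRep I η x) (extChartAt I x x) :=
    ((hη x).contDiffAt (extChartAt_target_mem_nhds x)).differentiableAt (by simp)
  have h := extDeriv_eq_fderiv_toLinearForm hd (mfderiv I 𝓘(ℝ, V) (extChartAt I x) x Y)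
    (mfderiv I 𝓘(ℝ, V) (extChartAt I x) x Z)
  refine Eq.trans ?_ h
  change extDeriv (localRep I η x) (extChartAt I x x)
    (mfderiv I 𝓘(ℝ, V) (extChartAt I x) x ∘ ![Y, Z]) = _
  congr 1
  ext i; fin_cases i <;> rfl

end Charts

/-! ### Maps read in charts, and submersivity of bundle projections -/

section Maps

variable {V : Type*} [NormedAddCommGroup V] [NormedSpace ℝ V]
  {H : Type*} [TopologicalSpace H] (I : ModelWithCorners ℝ V H) [I.Boundaryless]
  {X : Type*} [TopologicalSpace X] [ChartedSpace H X] [IsManifold I ∞ X]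
  {V' : Type*} [NormedAddCommGroup V'] [NormedSpace ℝ V']
  {H' : Type*} [TopologicalSpace H'] (I' : ModelWithCorners ℝ V' H') [I'.Boundaryless]
  {X' : Type*} [TopologicalSpace X'] [ChartedSpace H' X'] [IsManifold I' ∞ X']

/-- The domain, in the chart at `x₀`, on which `p` takes values in the chart at `p x₀`. -/
def chartDomain (p : X → X') (x₀ : X) : Set V :=
  (chartHomeomorph I x₀).target ∩
    (chartHomeomorph I x₀).symm ⁻¹' (p ⁻¹' (chartAt H' (p x₀)).source)

omit [IsManifold I ∞ X] in
theorem isOpen_chartDomain {p : X → X'} (hp : Continuous p) (x₀ : X) :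
    IsOpen (chartDomain (H' := H') I p x₀) :=
  (chartHomeomorph I x₀).isOpen_inter_preimage_symm ((chartAt H' (p x₀)).open_source.preimage hp)

theorem contDiffOn_writtenInExtChartAt {p : X → X'} (hp : ContMDiff I I' ∞ p) (x₀ : X) :
    ContDiffOn ℝ ∞ (writtenInExtChartAt I I' x₀ p) (chartDomain (H' := H') I p x₀) := by
  rw [← contMDiffOn_iff_contDiffOn]
  refine (contMDiffOn_chartHomeomorph I' (p x₀)).comp
    (hp.comp_contMDiffOn ((contMDiffOn_chartHomeomorph_symm I x₀).mono inter_subset_left)) ?_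
  exact fun y hy => hy.2

/-- Chain rule applied to the two sides of `P ∘ chart = chart ∘ p` near `x`. Points `x` other than
the centre matter because horizontality is needed on a whole neighbourhood. -/
theorem fderiv_writtenInExtChartAt {p : X → X'} (hp : ContMDiff I I' ∞ p) {x₀ x : X}
    (hx : x ∈ (chartAt H x₀).source) (hpx : p x ∈ (chartAt H' (p x₀)).source)
    (Y : TangentSpace I x) :
    fderiv ℝ (writtenInExtChartAt I I' x₀ p) (extChartAt I x₀ x)
        (mfderiv I 𝓘(ℝ, V) (extChartAt I x₀) x Y) =
      mfderiv I' 𝓘(ℝ, V') (extChartAt I' (p x₀)) (p x) (mfderiv I I' p x Y) := by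
  have : IsManifold I 1 X := IsManifold.of_le (n := ∞) (by simp)
  have : IsManifold I' 1 X' := IsManifold.of_le (n := ∞) (by simp)
  have hx' : (extChartAt I x₀).symm (extChartAt I x₀ x) = x :=
    (extChartAt I x₀).left_inv (by rwa [extChartAt_source])
  have hmem : extChartAt I x₀ x ∈ chartDomain (H' := H') I p x₀ := by
    refine ⟨(chartHomeomorph I x₀).map_source hx, ?_⟩
    change p ((extChartAt I x₀).symm (extChartAt I x₀ x)) ∈ (chartAt H' (p x₀)).source
    rwa [hx']
  have hP : MDifferentiableAt 𝓘(ℝ, V) 𝓘(ℝ, V') (writtenInExtChartAt I I' x₀ p)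
      (extChartAt I x₀ x) :=
    (((contDiffOn_writtenInExtChartAt I I' hp x₀).contDiffAt
      ((isOpen_chartDomain I hp.continuous x₀).mem_nhds hmem)).differentiableAt
        (by simp)).mdifferentiableAt
  have h1 := mfderiv_comp x hP (mdifferentiableAt_extChartAt (I := I) hx)
  have h2 := mfderiv_comp x (mdifferentiableAt_extChartAt (I := I') hpx)
    (hp.mdifferentiable (by simp) x)
  have heq : writtenInExtChartAt I I' x₀ p ∘ extChartAt I x₀ =ᶠ[𝓝 x]
      extChartAt I' (p x₀) ∘ p := by
    filter_upwards [(chartAt H x₀).open_source.mem_nhds hx] with z hz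
    simp only [writtenInExtChartAt, Function.comp_apply]
    rw [(extChartAt I x₀).left_inv (by rwa [extChartAt_source])]
  rw [heq.mfderiv_eq, h2, mfderiv_eq_fderiv] at h1
  exact (DFunLike.congr_fun h1 Y).symm

omit [I.Boundaryless] [IsManifold I ∞ X] [I'.Boundaryless] [IsManifold I' ∞ X'] in
/-- The projection of a smooth fiber bundle is a submersion. -/
theorem IsSmoothFiberBundle.mfderiv_surjective
    {F : Type*} [NormedAddCommGroup F] [NormedSpace ℝ F]
    {K : Type*} [TopologicalSpace K] {J : ModelWithCorners ℝ F K}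
    {S : Type*} [TopologicalSpace S] [ChartedSpace K S] {p : X → X'}
    (hp : IsSmoothFiberBundle I I' J S p) (u : X) :
    Function.Surjective (mfderiv I I' p u) := by
  obtain ⟨e, hu, -, he⟩ := hp.locally_trivial (p u)
  have heu : (p u, (e u).2) ∈ e.target := e.mem_target.2 hu
  have hbase : e.baseSet ∈ 𝓝 (p u) := e.open_baseSet.mem_nhds hu
  -- The local section through `u` with constant fiber coordinate; differentiating `p ∘ σ = id`
  -- yields a right inverse of the derivative of `p` at `u`.
  set σ : X' → X := fun x => e.toOpenPartialHomeomorph.symm (x, (e u).2)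
  have hσu : σ (p u) = u := e.symm_apply_mk_proj (e.mem_source.2 hu)
  have hσ : MDifferentiableAt I' I σ (p u) := by
    have h1 : ContMDiffAt (I'.prod J) I ∞ e.toOpenPartialHomeomorph.symm (p u, (e u).2) :=
      he.contMDiffAt (e.open_target.mem_nhds heu)
    have h2 : ContMDiffAt I' (I'.prod J) ∞ (fun x : X' => (x, (e u).2)) (p u) :=
      contMDiffAt_id.prodMk contMDiffAt_const
    exact (h1.comp (p u) h2).mdifferentiableAt (by simp)
  have hpσ : p ∘ σ =ᶠ[𝓝 (p u)] id := by
    filter_upwards [hbase] with x hx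
    exact e.proj_symm_apply' hx
  have hpd : MDifferentiableAt I I' p (σ (p u)) := hp.smooth.mdifferentiable (by simp) _
  have h := mfderiv_comp (p u) hpd hσ
  rw [hpσ.mfderiv_eq, mfderiv_id] at h
  intro w
  have hw : mfderiv I I' p (σ (p u)) (mfderiv I' I σ (p u) w) = w :=
    (DFunLike.congr_fun h w).symm
  -- The equality `σ (p u) = u` is not definitional, so the derivatives at these points are compared
  -- as maps between the model spaces.
  have hcongr : ∀ z, z = u → ∀ a : V, ((mfderiv I I' p z : V →L[ℝ] V') a) =
      (mfderiv I I' p u : V →L[ℝ] V') a := by rintro z rfl a; rfl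
  exact ⟨(mfderiv I' I σ (p u) w : V), (hcongr _ hσu _).symm.trans hw⟩

end Maps

/-! ### Charts of the cotangent bundle -/

section Cotangent

variable {V : Type*} [NormedAddCommGroup V] [NormedSpace ℝ V]
  {H : Type*} [TopologicalSpace H] (I : ModelWithCorners ℝ V H)
  {X : Type*} [TopologicalSpace X] [ChartedSpace H X] [IsManifold I ∞ X]

theorem isManifold_cotangentBundle :
    IsManifold (cotangentModel I) ∞ (CotangentBundle I X) := by
  -- Passing to the tangent bundle costs one derivative, which is free since `∞ + 1 = ∞`.
  have : IsManifold I (∞ + 1) X := ‹IsManifold I ∞ X›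
  infer_instance

theorem baseSet_cotangentTrivialization (x₀ : X) :
    (trivializationAt (V →L[ℝ] ℝ)
      (fun x : X => TangentSpace I x →L[ℝ] Bundle.Trivial X ℝ x) x₀).baseSet =
      (chartAt H x₀).source := by
  have : IsManifold I 1 X := IsManifold.of_le (n := ∞) (by simp)
  rw [hom_trivializationAt_baseSet]
  exact inter_univ _

variable [I.Boundaryless]

/-- Bundle charts contain entire fibers, so only the base coordinate is constrained. -/
theorem mem_target_cotangentChart (ξ₀ : CotangentBundle I X) {y : V × (V →L[ℝ] ℝ)}
    (hy : y.1 ∈ (extChartAt I ξ₀.proj).target) :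
    y ∈ (chartHomeomorph (cotangentModel I) ξ₀).target := by
  rw [chartHomeomorph_target, FiberBundle.extChartAt_target]
  refine ⟨⟨hy, ?_⟩, mem_univ _⟩
  rw [baseSet_cotangentTrivialization, mem_preimage, ← extChartAt_source I]
  exact (extChartAt I ξ₀.proj).map_target hy

theorem proj_mem_source_of_mem_cotangentChart {ξ₀ ξ : CotangentBundle I X}
    (hξ : ξ ∈ (chartHomeomorph (cotangentModel I) ξ₀).source) :
    ξ.proj ∈ (chartAt H ξ₀.proj).source := by
  rw [chartHomeomorph_source, FiberBundle.chartedSpace_chartAt] at hξ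
  have h := (Bundle.Trivialization.mem_source _).1 hξ.1
  rwa [baseSet_cotangentTrivialization] at h

theorem cotangentChart_fst (ξ₀ ξ : CotangentBundle I X) :
    (chartHomeomorph (cotangentModel I) ξ₀ ξ).1 = extChartAt I ξ₀.proj ξ.proj := by
  have : IsManifold I 1 X := IsManifold.of_le (n := ∞) (by simp)
  change ((cotangentModel I) (chartAt (ModelProd H (V →L[ℝ] ℝ)) ξ₀ ξ)).1 = _
  rw [hom_chart]
  rfl

/-- The fiber coordinate of `ξ` is `ξ` precomposed with the inverse of the tangent trivialization,
and that trivialization is the derivative of the base chart. -/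
theorem cotangentChart_snd {ξ₀ ξ : CotangentBundle I X}
    (hξ : ξ.proj ∈ (chartAt H ξ₀.proj).source) (Y : TangentSpace I ξ.proj) :
    (chartHomeomorph (cotangentModel I) ξ₀ ξ).2
      (mfderiv I 𝓘(ℝ, V) (extChartAt I ξ₀.proj) ξ.proj Y) = ξ.snd Y := by
  have : IsManifold I 1 X := IsManifold.of_le (n := ∞) (by simp)
  change ((cotangentModel I) (chartAt (ModelProd H (V →L[ℝ] ℝ)) ξ₀ ξ)).2 _ = _
  rw [hom_chart, ← TangentBundle.continuousLinearMapAt_trivializationAt hξ]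
  have h1 := (trivializationAt V (TangentSpace I) ξ₀.proj).symmL_continuousLinearMapAt
    (R := ℝ) (b := ξ.proj) hξ Y
  have h2 : ∀ a : V, ContinuousLinearMap.inCoordinates V (TangentSpace I) ℝ (Bundle.Trivial X ℝ)
      ξ₀.proj ξ.proj ξ₀.proj ξ.proj ξ.snd a =
      ξ.snd ((trivializationAt V (TangentSpace I) ξ₀.proj).symmL ℝ ξ.proj a) := by
    intro a
    exact DFunLike.congr_fun (Bundle.Trivial.continuousLinearMapAt_trivialization ℝ X ℝ ξ.proj) _
  exact (h2 _).trans (congrArg ξ.snd h1)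

end Cotangent

/-! ### Local normal form on manifolds -/

section LocalForm

variable {V : Type*} [NormedAddCommGroup V] [NormedSpace ℝ V] [FiniteDimensional ℝ V]
  {H : Type*} [TopologicalSpace H] {I : ModelWithCorners ℝ V H} [I.Boundaryless]
  {X : Type*} [TopologicalSpace X] [ChartedSpace H X] [IsManifold I ∞ X]
  {V' : Type*} [NormedAddCommGroup V'] [NormedSpace ℝ V'] [FiniteDimensional ℝ V']
  {H' : Type*} [TopologicalSpace H'] {I' : ModelWithCorners ℝ V' H'} [I'.Boundaryless]
  {X' : Type*} [TopologicalSpace X'] [ChartedSpace H' X'] [IsManifold I' ∞ X']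

/-- In the charts at `u` and `p u`, a Liouville form of a submersion `p` is the pullback of the
canonical form `q dp` under a local diffeomorphism. -/
theorem IsLiouvilleForm.exists_canonical_coordinates {p : X → X'} (hp : ContMDiff I I' ∞ p)
    {Ω : Form I X 2} (hΩ : IsSymplecticForm I Ω) {Θ : Form I X 1}
    (hΘ : IsLiouvilleForm I I' p Ω Θ) {u : X} (hsurj : Function.Surjective (mfderiv I I' p u)) :
    ∃ ψ : OpenPartialHomeomorph V (V' × (V' →L[ℝ] ℝ)), extChartAt I u u ∈ ψ.source ∧
      ψ.source ⊆ chartDomain (H' := H') I p u ∧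
      ContDiffOn ℝ ∞ ψ ψ.source ∧ ContDiffOn ℝ ∞ ψ.symm ψ.target ∧
      ∀ y ∈ ψ.source, (ψ y).1 = writtenInExtChartAt I I' u p y ∧
        toLinearForm (localRep I Θ u) y =
          (ψ y).2.comp (fderiv ℝ (writtenInExtChartAt I I' u p) y) := by
  have hu : u ∈ (chartAt H u).source := mem_chart_source H u
  have hpu : p u ∈ (chartAt H' (p u)).source := mem_chart_source H' (p u)
  have hbij := mfderiv_extChartAt_bijective I hu
  have hbij' := mfderiv_extChartAt_bijective I' hpu
  -- The chart of `X` carries vertical spaces to kernels of `DP`, because the chart of `X'` has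
  -- injective derivative.
  have hker : ∀ {x : X}, x ∈ (chartAt H u).source → p x ∈ (chartAt H' (p u)).source →
      ∀ Y : TangentSpace I x, fderiv ℝ (writtenInExtChartAt I I' u p) (extChartAt I u x)
        (mfderiv I 𝓘(ℝ, V) (extChartAt I u) x Y) = 0 ↔ Y ∈ verticalSpace I I' p x := by
    intro x hx hpx Y
    have h := fderiv_writtenInExtChartAt I I' hp hx hpx Y
    have hinj := (mfderiv_extChartAt_bijective I' hpx).injective
    constructor
    · intro h0
      exact hinj ((h.symm.trans h0).trans (map_zero _).symm)
    · intro h0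
      exact h.trans ((congrArg _ h0).trans (map_zero _))
  have hΩΘ : ∀ Y Z : TangentSpace I u, Ω u ![Y, Z] =
      fderiv ℝ (toLinearForm (localRep I Θ u)) (extChartAt I u u)
          (mfderiv I 𝓘(ℝ, V) (extChartAt I u) u Y) (mfderiv I 𝓘(ℝ, V) (extChartAt I u) u Z) -
        fderiv ℝ (toLinearForm (localRep I Θ u)) (extChartAt I u u)
          (mfderiv I 𝓘(ℝ, V) (extChartAt I u) u Z)
          (mfderiv I 𝓘(ℝ, V) (extChartAt I u) u Y) := by
    intro Y Z
    rw [hΘ.eq_extDeriv]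
    exact extDerivForm_apply I hΘ.smooth u Y Z
  refine LiouvilleBundle.exists_canonical_coordinates (isOpen_chartDomain I hp.continuous u) ?_
    (contDiffOn_writtenInExtChartAt I I' hp u) ?_ ?_ ?_ ?_ ?_
  · refine ⟨(chartHomeomorph I u).map_source hu, ?_⟩
    change p ((chartHomeomorph I u).symm (chartHomeomorph I u u)) ∈ (chartAt H' (p u)).source
    rwa [(chartHomeomorph I u).left_inv hu]
  · refine (contDiffOn_toLinearForm (hΘ.smooth u)).mono fun y hy => ?_
    rw [← chartHomeomorph_target]
    exact hy.1
  · intro w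
    obtain ⟨w', rfl⟩ := hbij'.surjective w
    obtain ⟨Y, rfl⟩ := hsurj w'
    exact ⟨_, fderiv_writtenInExtChartAt I I' hp hu hpu Y⟩
  · rintro y ⟨hy, hpy⟩ v hv
    obtain ⟨x, hx, rfl⟩ : ∃ x ∈ (chartAt H u).source, extChartAt I u x = y :=
      ⟨_, (chartHomeomorph I u).map_target hy, (chartHomeomorph I u).right_inv hy⟩
    have hpx : p x ∈ (chartAt H' (p u)).source := by
      have hleft : (chartHomeomorph I u).symm (extChartAt I u x) = x :=
        (chartHomeomorph I u).left_inv hx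
      rwa [mem_preimage, hleft] at hpy
    obtain ⟨Y, rfl⟩ := (mfderiv_extChartAt_bijective I hx).surjective v
    exact (toLinearForm_localRep I Θ hx Y).trans
      (hΘ.horizontal x Y ((hker hx hpx Y).1 hv))
  · intro v hv
    obtain ⟨Y, rfl⟩ := hbij.surjective v
    have hY : Y = 0 := hΩ.nondegenerate u Y fun Z => (hΩΘ Y Z).trans (hv _)
    rw [hY]
    exact map_zero _
  · intro v
    obtain ⟨Y, rfl⟩ := hbij.surjective v
    refine (hker hu hpu Y).trans
      ((hΘ.lagrangian_fibers u Y).trans ⟨fun h w hw => ?_, fun h Z hZ => ?_⟩)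
    · obtain ⟨Z, rfl⟩ := hbij.surjective w
      exact (hΩΘ Y Z).symm.trans (h Z ((hker hu hpu Z).1 hw))
    · exact (hΩΘ Y Z).trans (h _ ((hker hu hpu Z).2 hZ))

/-- A Liouville form of a submersion `p` is locally the pullback of the canonical Liouville form of
the cotangent bundle by a diffeomorphism over the base. -/
theorem IsLiouvilleForm.exists_local_diffeomorph {p : X → X'} (hp : ContMDiff I I' ∞ p)
    {Ω : Form I X 2} (hΩ : IsSymplecticForm I Ω) {Θ : Form I X 1}
    (hΘ : IsLiouvilleForm I I' p Ω Θ) {u : X} (hsurj : Function.Surjective (mfderiv I I' p u)) :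
    ∃ φ : OpenPartialHomeomorph X (CotangentBundle I' X'),
      u ∈ φ.source ∧
      ContMDiffOn I (cotangentModel I') ∞ φ φ.source ∧
      ContMDiffOn (cotangentModel I') I ∞ φ.symm φ.target ∧
      (∀ v ∈ φ.source, (φ v).proj = p v) ∧
      (∀ v ∈ φ.source,
        pullback I (cotangentModel I') φ (canonicalLiouvilleForm I' (X := X')) v = Θ v) := by
  have : IsManifold I' 1 X' := IsManifold.of_le (n := ∞) (by simp)
  have := isManifold_cotangentBundle I' (X := X')
  obtain ⟨ψ, hψu, hψD, hψ, hψs, hψy⟩ :=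
    hΘ.exists_canonical_coordinates hp hΩ hsurj
  -- The zero covector is an arbitrary choice: the chart at any covector over `p u` covers all fiber
  -- coordinates.
  let ξ₀ : CotangentBundle I' X' := ⟨p u, 0⟩
  let cX := chartHomeomorph I u
  let cT := chartHomeomorph (cotangentModel I') ξ₀
  let φ : OpenPartialHomeomorph X (CotangentBundle I' X') := cX.trans (ψ.trans cT.symm)
  have hpv : ∀ v ∈ cX.source, cX v ∈ ψ.source → p v ∈ (chartAt H' (p u)).source := by
    intro v hv hψv
    have h : p (cX.symm (cX v)) ∈ (chartAt H' (p u)).source := (hψD hψv).2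
    rwa [cX.left_inv hv] at h
  have hfst : ∀ v ∈ cX.source, cX v ∈ ψ.source → (ψ (cX v)).1 = extChartAt I' (p u) (p v) := by
    intro v hv hψv
    rw [(hψy _ hψv).1]
    change extChartAt I' (p u) (p (cX.symm (cX v))) = _
    rw [cX.left_inv hv]
  have hmem : ∀ v ∈ cX.source, cX v ∈ ψ.source → ψ (cX v) ∈ cT.target := by
    intro v hv hψv
    refine mem_target_cotangentChart I' ξ₀ ?_
    rw [hfst v hv hψv]
    exact (extChartAt I' (p u)).map_source (by
      rw [extChartAt_source]; exact hpv v hv hψv)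
  have hsrc : ∀ v ∈ φ.source, v ∈ cX.source ∧ cX v ∈ ψ.source ∧ ψ (cX v) ∈ cT.target :=
    fun v hv => hv
  have hproj : ∀ v ∈ φ.source, (φ v).proj = p v := by
    intro v hvφ
    obtain ⟨hv, hψv, hT⟩ := hsrc v hvφ
    -- The points `(φ v).proj` and `p v` have the same coordinates in the chart at `p u`, which is
    -- injective on its source.
    have h1 : (cT (cT.symm (ψ (cX v)))).1 = extChartAt I' (p u) (φ v).proj :=
      cotangentChart_fst I' ξ₀ (φ v)
    rw [cT.right_inv hT, hfst v hv hψv] at h1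
    refine (extChartAt I' (p u)).injOn ?_ ?_ h1.symm
    · rw [extChartAt_source]
      exact proj_mem_source_of_mem_cotangentChart I' (cT.map_target hT)
    · rw [extChartAt_source]
      exact hpv v hv hψv
  have hφ : ContMDiffOn I (cotangentModel I') ∞ φ φ.source := by
    refine (contMDiffOn_chartHomeomorph_symm (cotangentModel I') ξ₀).comp
      ((contMDiffOn_iff_contDiffOn.2 hψ).comp
        ((contMDiffOn_chartHomeomorph I u).mono fun v hv => hv.1) fun v hv => hv.2.1)
      fun v hv => hv.2.2
  have hφs : ContMDiffOn (cotangentModel I') I ∞ φ.symm φ.target := by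
    refine (contMDiffOn_chartHomeomorph_symm I u).comp
      ((contMDiffOn_iff_contDiffOn.2 hψs).comp
        ((contMDiffOn_chartHomeomorph (cotangentModel I') ξ₀).mono fun ξ hξ => hξ.1.1)
          fun ξ hξ => hξ.1.2)
      fun ξ hξ => hξ.2
  refine ⟨φ, ⟨mem_chart_source H u, hψu, hmem u (mem_chart_source H u) hψu⟩, hφ, hφs, hproj, ?_⟩
  intro v hvφ
  obtain ⟨hv, hψv, hT⟩ := hsrc v hvφ
  have hξ : (φ v).proj ∈ (chartAt H' ξ₀.proj).source :=
    proj_mem_source_of_mem_cotangentChart I' (cT.map_target hT)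
  have hcomp : ∀ Y : V, (mfderiv (cotangentModel I') I'
      (Bundle.TotalSpace.proj : CotangentBundle I' X' → X') (φ v)
        (mfderiv I (cotangentModel I') φ v Y) : V') = (mfderiv I I' p v Y : V') := by
    intro Y
    have hπ : MDifferentiableAt (cotangentModel I') I'
        (Bundle.TotalSpace.proj : CotangentBundle I' X' → X') (φ v) :=
      (Bundle.contMDiff_proj (n := ∞) (IB := I') _).mdifferentiable (by simp) _
    have hφv : MDifferentiableAt I (cotangentModel I') φ v :=
      (hφ.contMDiffAt (φ.open_source.mem_nhds hvφ)).mdifferentiableAt (by simp)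
    have h := mfderiv_comp v hπ hφv
    have heq : (Bundle.TotalSpace.proj : CotangentBundle I' X' → X') ∘ φ =ᶠ[𝓝 v] p := by
      filter_upwards [φ.open_source.mem_nhds hvφ] with z hz using hproj z hz
    rw [heq.mfderiv_eq] at h
    exact (DFunLike.congr_fun h Y).symm
  have hbase : ∀ z, z = p v → ∀ a : V',
      (mfderiv I' 𝓘(ℝ, V') (extChartAt I' (p u)) z : V' →L[ℝ] V') a =
        (mfderiv I' 𝓘(ℝ, V') (extChartAt I' (p u)) (p v) : V' →L[ℝ] V') a := by
    rintro z rfl a; rfl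
  -- With `q` the second component of `ψ` at `cX v`, and `c`, `c'` the charts of `X`, `X'`: `φ(v)(Tp
  -- Y) = q(Tc' (Tp Y)) = q(DP (Tc Y)) = θ(Tc Y) = Θ(Y)`.
  have hmain : ∀ Y : V, (φ v).snd (mfderiv I I' p v Y : V') = Θ v ![Y] := by
    intro Y
    have h1 := cotangentChart_snd I' hξ (mfderiv I I' p v Y : V')
    have h2 : cT (φ v) = ψ (cX v) := cT.right_inv hT
    have h3 : toLinearForm (localRep I Θ u) (cX v)
        (mfderiv I 𝓘(ℝ, V) (extChartAt I u) v Y : V) = Θ v ![Y] :=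
      toLinearForm_localRep I Θ hv Y
    have h4 := fderiv_writtenInExtChartAt I I' hp hv (hpv v hv hψv) Y
    refine h1.symm.trans (Eq.trans ?_ ((DFunLike.congr_fun (hψy _ hψv).2 _).symm.trans h3))
    refine (congrArg (fun y : V' × (V' →L[ℝ] ℝ) => y.2 _) h2).trans ?_
    exact congrArg (ψ (cX v)).2 ((hbase _ (hproj v hvφ) _).trans h4.symm)
  ext w
  have hw : w = ![w 0] := by ext i; fin_cases i; rfl
  refine (congrArg (φ v).snd (hcomp (w 0))).trans ((hmain (w 0)).trans ?_)
  rw [← hw]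

end LocalForm

end LiouvilleBundle

end

theorem lemma1p1
    {VE : Type*} [NormedAddCommGroup VE] [NormedSpace ℝ VE] [FiniteDimensional ℝ VE]
    {HE : Type*} [TopologicalSpace HE] (IE : ModelWithCorners ℝ VE HE) [IE.Boundaryless]
    {E : Type*} [TopologicalSpace E] [ChartedSpace HE E] [IsManifold IE ∞ E]
    {VM : Type*} [NormedAddCommGroup VM] [NormedSpace ℝ VM] [FiniteDimensional ℝ VM]
    {HM : Type*} [TopologicalSpace HM] (IM : ModelWithCorners ℝ VM HM) [IM.Boundaryless]
    {M : Type*} [TopologicalSpace M] [ChartedSpace HM M] [IsManifold IM ∞ M]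
    {VS : Type*} [NormedAddCommGroup VS] [NormedSpace ℝ VS] [FiniteDimensional ℝ VS]
    {HS : Type*} [TopologicalSpace HS] (IS : ModelWithCorners ℝ VS HS) [IS.Boundaryless]
    {S : Type*} [TopologicalSpace S] [ChartedSpace HS S] [IsManifold IS ∞ S]
    (p : E → M) (hp : LiouvilleBundle.IsSmoothFiberBundle IE IM IS S p)
    (Ω : LiouvilleBundle.Form IE E 2) (hΩ : LiouvilleBundle.IsSymplecticForm IE Ω)
    (Θ : LiouvilleBundle.Form IE E 1) (hΘ : LiouvilleBundle.IsLiouvilleForm IE IM p Ω Θ) :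
    ∀ u : E, ∃ φ : OpenPartialHomeomorph E (LiouvilleBundle.CotangentBundle IM M),
      u ∈ φ.source ∧
      ContMDiffOn IE (LiouvilleBundle.cotangentModel IM) ∞ φ φ.source ∧
      ContMDiffOn (LiouvilleBundle.cotangentModel IM) IE ∞ φ.symm φ.target ∧
      (∀ v ∈ φ.source, (φ v).proj = p v) ∧
      (∀ v ∈ φ.source,
        LiouvilleBundle.pullback IE (LiouvilleBundle.cotangentModel IM) φ
          (LiouvilleBundle.canonicalLiouvilleForm IM (X := M)) v = Θ v) :=
  fun u => hΘ.exists_local_diffeomorph hp.smooth hΩ (hp.mfderiv_surjective IE IM u)
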